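/- Let $X$ be a locally path connected and semilocally simply connected topological space (each point $x\in X$ has a neighbourhood $U$ such that the homomorphism $\pi_1(U,x)\to\pi_1(X,x)$ induced by the inclusion is trivial). Let $I=[0,1]$, let $C(I,X)$ be the space of paths in $X$ with the compact-open topology, and let $\Pi_1(X)$ be the space of arrows of the fundamental groupoid, i.e. the set of endpoint-fixing homotopy classes of paths in $X$, with the quotient topology from $C(I,X)$. Here "second countable" means having a countable basis; no separation axiom is included. (a) If $X$ is path connected and $p\colon\tilde X\to X$ is a simply connected covering space, then the following are equivalent: (1) $X$ is second countable; (2) $\tilde X$ is second countable; (3) $C(I,X)$ is second countable; (4) $\Pi_1(X)$ is second countable. If moreover $X$ is Hausdorff, then the same equivalence holds with "second countable" replaced by "Hausdorff and second countable" in each of (1)–(4). (b) Without assuming $X$ path connected, (1), (3) and (4) are equivalent, and they are also equivalent with "second countable" replaced by "Hausdorff and second countable" in each of them. -/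

import Mathlib

open scoped unitInterval Topology

/-- `X` is semilocally simply connected: every point `x` has a neighbourhood `U` for which the
homomorphism `π₁(U, x) → π₁(X, x)` induced by the inclusion is trivial. -/
def SemilocallySimplyConnected (X : Type*) [TopologicalSpace X] : Prop :=
  ∀ x : X, ∃ U ∈ 𝓝 x, ∃ hx : x ∈ U, ∀ g : FundamentalGroup U ⟨x, hx⟩,
    FundamentalGroup.map (⟨Subtype.val, continuous_subtype_val⟩ : C(U, X)) ⟨x, hx⟩ g = 1

/-- Homotopy relative to the two endpoints, as an equivalence relation on `C(I, X)`. -/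
def pathHomotopySetoid (X : Type*) [TopologicalSpace X] : Setoid C(I, X) where
  r f g := f.HomotopicRel g {0, 1}
  iseqv := ContinuousMap.HomotopicRel.equivalence

/-- The space of arrows of the fundamental groupoid of `X`: the set of all endpoint-fixing homotopy
classes of paths in `X`. -/
def Pi1 (X : Type*) [TopologicalSpace X] : Type _ :=
  Quotient (pathHomotopySetoid X)

/-- The topology of `Pi1 X` is the quotient of the compact-open topology on `C(I, X)`. -/
instance instTopologicalSpacePi1 (X : Type*) [TopologicalSpace X] : TopologicalSpace (Pi1 X) :=
  inferInstanceAs (TopologicalSpace (Quotient (pathHomotopySetoid X)))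

/-- Hausdorff and second countable. -/
def HausdorffSecondCountable (X : Type*) [TopologicalSpace X] : Prop :=
  T2Space X ∧ SecondCountableTopology X

/-!
Evaluation at the endpoints and constant paths exhibit `X` as a retract, hence a subspace, of both
`C(I, X)` and `Pi1 X`. So both properties pass from either of these spaces to `X`, and only the
converse needs work. For `C(I, X)` it is a general fact about the compact-open topology.

For `Pi1 X` the point is a description of its topology. Let `slideSet U V γ` be the set of classes
of paths `α⁻¹ γ β`, where `α` runs in `U` from the source of `γ` and `β` runs in `V` from its
target. For open `U` and `V` these sets are open (`Pi1.isOpen_slideSet`). This rests on a ladder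
argument (`eventually_slide`): if `g` is close to `γ` in the compact-open topology, subdivide `I` so
that `γ` maps each piece into an open set in which paths are determined up to homotopy in `X` by
their endpoints, and join the subdivision points of `γ` to those of `g` by short paths. Conversely
every neighbourhood of the class of `γ` contains some `slideSet U V γ`
(`Pi1.exists_slideSet_subset`), because `α⁻¹ γ β` depends continuously on `α` and `β` and is
homotopic to `γ` when they are constant. Sliding by paths in fixed `U` and `V` is symmetric and
transitive, so every nonempty such set is `slideSet U V d` with `d` in a given dense set of paths; taking
this dense set countable and `U`, `V` from a countable basis of `X` gives a countable basis of
`Pi1 X`. If `X` is Hausdorff, classes with different endpoints are separated by their endpoints, and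
distinct classes with the same endpoints by two slide sets with the same small `U` and `V`.

For a covering `p : E → X` with `E` path connected, lifting to a fixed point of `E` maps the space
of paths in `X` with suitable endpoints continuously onto a given fibre. If `X` is second countable,
so is this space of paths, hence it is separable and the discrete fibre is countable. Then `E` is a
countable union of open sets `p ⁻¹' U`, each homeomorphic to the product of `U` and a countable
discrete space. The converse holds because `p` is an open surjection, and `E` is Hausdorff with `X`
because covering maps are separated.
-/

section

open Set Filter TopologicalSpace Topology

local notation "⟦" γ "⟧ₕ" => Path.Homotopic.Quotient.mk γ

variable {X : Type*} [TopologicalSpace X]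

/-! ### Homotopy classes of paths in small sets -/

namespace Path.Homotopic.Quotient

variable {a b c : X}

theorem symm_trans_cancel_left (p : Path.Homotopic.Quotient a b)
    (q : Path.Homotopic.Quotient b c) : p.symm.trans (p.trans q) = q := by
  rw [← trans_assoc, symm_trans, refl_trans]

theorem trans_right_cancel {p q : Path.Homotopic.Quotient a b} {r : Path.Homotopic.Quotient b c}
    (h : p.trans r = q.trans r) : p = q := by
  simpa using congrArg (·.trans r.symm) h

end Path.Homotopic.Quotient

/-- A set of `X` in which paths are determined by their endpoints, up to homotopy in `X`. -/
def IsRelSimplyConnected (U : Set X) : Prop :=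
  ∀ ⦃a b : X⦄ (f g : Path a b), (∀ t, f t ∈ U) → (∀ t, g t ∈ U) → ⟦f⟧ₕ = ⟦g⟧ₕ

theorem IsRelSimplyConnected.mono {U V : Set X} (hV : IsRelSimplyConnected V) (h : U ⊆ V) :
    IsRelSimplyConnected U :=
  fun _ _ f g hf hg ↦ hV f g (fun t ↦ h (hf t)) fun t ↦ h (hg t)

theorem Path.trans_mem {U : Set X} {a b c : X} {f : Path a b} {g : Path b c}
    (hf : ∀ t, f t ∈ U) (hg : ∀ t, g t ∈ U) (t : I) : f.trans g t ∈ U := by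
  have h : range (f.trans g) ⊆ U := by
    rw [Path.trans_range]
    exact union_subset (range_subset_iff.2 hf) (range_subset_iff.2 hg)
  exact h ⟨t, rfl⟩

/-- The path component of `x` in a set whose loops at `x` are null-homotopic in `X` works: two
paths with the same endpoints, joined to `x`, form such a loop. -/
theorem SemilocallySimplyConnected.exists_isRelSimplyConnected [LocallyPathConnectedSpace X]
    (hX : SemilocallySimplyConnected X) (x : X) :
    ∃ U ∈ 𝓝 x, IsRelSimplyConnected U := by
  obtain ⟨U, hU, hxU, hloop⟩ := hX x
  have null (l : Path x x) (hl : ∀ t, l t ∈ U) : ⟦l⟧ₕ = .refl x :=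
    hloop (Path.Homotopic.Quotient.mk
      ({ toFun := fun t ↦ ⟨l t, hl t⟩
         source' := Subtype.ext l.source
         target' := Subtype.ext l.target } : Path (⟨x, hxU⟩ : U) ⟨x, hxU⟩))
  refine ⟨pathComponentIn U x, pathComponentIn_mem_nhds hU, fun a b f g hf hg ↦ ?_⟩
  have ha : JoinedIn U x a := f.source ▸ hf 0
  obtain ⟨c, hc⟩ := ha
  have hfU (t : I) : f t ∈ U := pathComponentIn_subset (hf t)
  have hgU (t : I) : g t ∈ U := pathComponentIn_subset (hg t)
  have key := null ((c.trans (f.trans g.symm)).trans c.symm)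
    (Path.trans_mem (Path.trans_mem hc (Path.trans_mem hfU fun t ↦ hgU _)) fun t ↦ hc _)
  simp only [Path.Homotopic.Quotient.mk_trans, Path.Homotopic.Quotient.mk_symm] at key
  simpa [Path.Homotopic.Quotient.symm_trans_cancel_left] using
    congrArg (fun k ↦ ⟦c⟧ₕ.symm.trans (k.trans (⟦c⟧ₕ.trans ⟦g⟧ₕ))) key

/-! ### Moving the endpoints of a path -/

/-- `Slide U V γ γ'` says that the path `γ'` is homotopic to `γ` with its source moved along a path
in `U` and its target moved along a path in `V`. This is encoded as the commutation, up to homotopy,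
of the square with sides `γ`, `γ'` and the two paths of endpoints. -/
def Slide (U V : Set X) {a b a' b' : X} (γ : Path a b) (γ' : Path a' b') : Prop :=
  ∃ (α : Path a a') (β : Path b b'), (∀ t, α t ∈ U) ∧ (∀ t, β t ∈ V) ∧
    ⟦γ⟧ₕ.trans ⟦β⟧ₕ = ⟦α⟧ₕ.trans ⟦γ'⟧ₕ

namespace Slide

variable {U V : Set X} {a b a' b' a'' b'' : X} {γ : Path a b} {γ' : Path a' b'} {γ'' : Path a'' b''}

theorem of_homotopic {γ₁ : Path a b} (ha : a ∈ U) (hb : b ∈ V) (h : γ.Homotopic γ₁) :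
    Slide U V γ γ₁ :=
  ⟨.refl a, .refl b, fun _ ↦ ha, fun _ ↦ hb, by simp [Path.Homotopic.Quotient.eq.2 h]⟩

theorem symm (h : Slide U V γ γ') : Slide U V γ' γ := by
  obtain ⟨α, β, hα, hβ, h⟩ := h
  refine ⟨α.symm, β.symm, fun _ ↦ hα _, fun _ ↦ hβ _, ?_⟩
  simpa [Path.Homotopic.Quotient.symm_trans_cancel_left] using
    congrArg (fun k ↦ ⟦α⟧ₕ.symm.trans (k.trans ⟦β⟧ₕ.symm)) h.symm

theorem trans (h : Slide U V γ γ') (h' : Slide U V γ' γ'') : Slide U V γ γ'' := by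
  obtain ⟨α, β, hα, hβ, h⟩ := h
  obtain ⟨α', β', hα', hβ', h'⟩ := h'
  refine ⟨α.trans α', β.trans β', Path.trans_mem hα hα', Path.trans_mem hβ hβ', ?_⟩
  simp only [Path.Homotopic.Quotient.mk_trans]
  grind

theorem mono {U' V' : Set X} (hU : U ⊆ U') (hV : V ⊆ V') (h : Slide U V γ γ') :
    Slide U' V' γ γ' := by
  obtain ⟨α, β, hα, hβ, h⟩ := h
  exact ⟨α, β, fun t ↦ hU (hα t), fun t ↦ hV (hβ t), h⟩

/-- Slides of consecutive paths glue: in a set `V` where paths are determined by their endpoints,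
the two ways of moving the common endpoint agree. -/
theorem comp {W : Set X} {c c' : X} {δ : Path b c} {δ' : Path b' c'} (hV : IsRelSimplyConnected V)
    (h : Slide U V γ γ') (h' : Slide V W δ δ') : Slide U W (γ.trans δ) (γ'.trans δ') := by
  obtain ⟨α, β, hα, hβ, h⟩ := h
  obtain ⟨α', β', hα', hβ', h'⟩ := h'
  have := hV β α' hβ hα'
  refine ⟨α, β', hα, hβ', ?_⟩
  simp only [Path.Homotopic.Quotient.mk_trans]
  grind

theorem congr {γ₁ : Path a b} {γ₁' : Path a' b'} (h : Slide U V γ γ') (h₁ : γ.Homotopic γ₁)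
    (h₁' : γ'.Homotopic γ₁') : Slide U V γ₁ γ₁' := by
  obtain ⟨α, β, hα, hβ, h⟩ := h
  exact ⟨α, β, hα, hβ, by
    rwa [← Path.Homotopic.Quotient.eq.2 h₁, ← Path.Homotopic.Quotient.eq.2 h₁']⟩

/-- Sliding within small sets is injective on homotopy classes of paths with given endpoints. -/
theorem homotopic_of_slide {γ₁ : Path a b} (hU : IsRelSimplyConnected U)
    (hV : IsRelSimplyConnected V) (h : Slide U V γ γ') (h' : Slide U V γ₁ γ') :
    γ.Homotopic γ₁ := by
  obtain ⟨α, β, hα, hβ, h⟩ := h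
  obtain ⟨α', β', hα', hβ', h'⟩ := h'
  have h1 := hU α α' hα hα'
  have h2 := hV β β' hβ hβ'
  refine Path.Homotopic.Quotient.eq.1 (Path.Homotopic.Quotient.trans_right_cancel (h.trans ?_))
  rw [h1, h2, h']

end Slide

/-! ### The compact-open topology on paths -/

/-- A continuous map on the unit interval, as a path between its endpoints. -/
def ContinuousMap.toPath (f : C(I, X)) : Path (f 0) (f 1) := ⟨f, rfl, rfl⟩

/-- One rung of the ladder: the piece of `f` in question stays in a set `W` where paths are
determined by their endpoints, so every square with sides in `W` commutes. -/
theorem eventually_slide_subpath_of_mapsTo {f : C(I, X)} {W : Set X} [LocallyPathConnectedSpace X]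
    (hW : IsOpen W) (hWs : IsRelSimplyConnected W) {s u : I} (hf : ∀ t ∈ uIcc s u, f t ∈ W)
    {U V : Set X} (hU : U ∈ 𝓝 (f s)) (hV : V ∈ 𝓝 (f u)) :
    ∀ᶠ g : C(I, X) in 𝓝 f, Slide U V (f.toPath.subpath s u) (g.toPath.subpath s u) := by
  have hU' := pathComponentIn_mem_nhds (inter_mem hU (hW.mem_nhds (hf s left_mem_uIcc)))
  have hV' := pathComponentIn_mem_nhds (inter_mem hV (hW.mem_nhds (hf u right_mem_uIcc)))
  have evs := (continuous_eval_const (F := C(I, X)) s).continuousAt.eventually hU'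
  have evu := (continuous_eval_const (F := C(I, X)) u).continuousAt.eventually hV'
  filter_upwards [evs, evu, ContinuousMap.eventually_mapsTo isCompact_uIcc hW hf] with g hs hu hg
  obtain ⟨α, hα⟩ := hs
  obtain ⟨β, hβ⟩ := hu
  have sub {h : C(I, X)} (hh : ∀ t ∈ uIcc s u, h t ∈ W) (t : I) :
      h.toPath.subpath s u t ∈ W := by
    have : range (h.toPath.subpath s u) ⊆ W := by
      rw [Path.range_subpath]
      exact image_subset_iff.2 hh
    exact this ⟨t, rfl⟩
  refine ⟨α, β, fun t ↦ (hα t).1, fun t ↦ (hβ t).1, ?_⟩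
  exact hWs (Path.trans _ _) (Path.trans _ _) (Path.trans_mem (sub hf) fun t ↦ (hβ t).2)
    (Path.trans_mem (fun t ↦ (hα t).2) (sub hg))

/-- The ladder argument: a path close to `f` in the compact-open topology is, up to homotopy,
`f` with its endpoints moved slightly. -/
theorem eventually_slide [LocallyPathConnectedSpace X] (hX : SemilocallySimplyConnected X)
    (f : C(I, X)) {U V : Set X} (hU : U ∈ 𝓝 (f 0)) (hV : V ∈ 𝓝 (f 1)) :
    ∀ᶠ g : C(I, X) in 𝓝 f, Slide U V f.toPath g.toPath := by
  choose S hS hSs using hX.exists_isRelSimplyConnected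
  obtain ⟨t, ht0, htm, ⟨N, hN⟩, ht⟩ := exists_monotone_Icc_subset_open_cover_unitInterval
    (c := fun r : I ↦ f ⁻¹' interior (S (f r))) (fun r ↦ isOpen_interior.preimage f.continuous)
    (fun r _ ↦ mem_iUnion.2 ⟨r, mem_interior_iff_mem_nhds.2 (hS _)⟩)
  have step (n : ℕ) {U V : Set X} (hU : U ∈ 𝓝 (f (t n))) (hV : V ∈ 𝓝 (f (t (n + 1)))) :
      ∀ᶠ g : C(I, X) in 𝓝 f, Slide U V (f.toPath.subpath (t n) (t (n + 1)))
        (g.toPath.subpath (t n) (t (n + 1))) := by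
    obtain ⟨r, hr⟩ := ht n
    refine eventually_slide_subpath_of_mapsTo isOpen_interior ((hSs (f r)).mono interior_subset) ?_
      hU hV
    rw [uIcc_of_le (htm n.le_succ)]
    exact hr
  -- The neighbourhood `V` of the last endpoint varies, so that the next rung can be glued.
  have main (n : ℕ) : ∀ {V : Set X}, V ∈ 𝓝 (f (t (n + 1))) →
      ∀ᶠ g : C(I, X) in 𝓝 f, Slide U V (f.toPath.subpath (t 0) (t (n + 1)))
        (g.toPath.subpath (t 0) (t (n + 1))) := by
    induction n with
    | zero => exact fun hV ↦ step 0 (by rwa [ht0]) hV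
    | succ n ih =>
      intro V hV
      filter_upwards [ih (hS _), step (n + 1) (hS _) hV] with g h1 h2
      exact (h1.comp (hSs _) h2).congr ⟨.subpathTransSubpath _ _ _ _⟩
        ⟨.subpathTransSubpath _ _ _ _⟩
  -- `t (N + 1) = 1` as well; using it avoids treating the case of no rung.
  have := main N (V := V) (by rwa [hN _ N.le_succ])
  rw [ht0, hN _ N.le_succ] at this
  have whole (g : C(I, X)) : g.toPath.subpath 0 1 = g.toPath := Path.subpath_zero_one _
  simp only [whole] at this
  exact this

theorem ContinuousMap.isEmbedding_const_unitInterval :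
    IsEmbedding fun x : X ↦ ContinuousMap.const I x :=
  Function.LeftInverse.isEmbedding (f := fun f : C(I, X) ↦ f 0) (fun _ ↦ rfl)
    (continuous_eval_const (F := C(I, X)) 0) ContinuousMap.continuous_const'

/-- If an open set of paths contains `γ` with constant paths attached at both ends, then it contains
everything obtained from `γ` by attaching short paths at both ends. -/
theorem exists_nhds_forall_trans_mem {a b : X} (γ : Path a b) {W : Set C(I, X)} (hW : IsOpen W)
    (hγ : (((Path.refl a).symm.trans (γ.trans (Path.refl b)) : Path a b) : C(I, X)) ∈ W) :
    ∃ U ∈ 𝓝 a, ∃ V ∈ 𝓝 b, ∀ ⦃a' b' : X⦄ (α : Path a a') (β : Path b b'), (∀ t, α t ∈ U) →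
      (∀ t, β t ∈ V) → ((α.symm.trans (γ.trans β) : Path a' b') : C(I, X)) ∈ W := by
  -- The paths starting at `x`, with free target, and the tautological family of paths over them.
  let A (x : X) := {α : C(I, X) // α 0 = x}
  let P {x : X} (α : A x) : Path x (α.1 1) := ⟨α.1, α.2, rfl⟩
  have hP (x : X) : Continuous fun q : A x × I ↦ P q.1 q.2 :=
    ContinuousEval.continuous_eval.comp (continuous_subtype_val.prodMap continuous_id)
  have hcont : Continuous fun q : A a × A b ↦
      ((((P q.1).symm.trans (γ.trans (P q.2)) : Path _ _)) : C(I, X)) := by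
    refine ContinuousMap.continuous_of_continuous_uncurry _ ?_
    refine Path.trans_continuous_family (fun q : A a × A b ↦ (P q.1).symm) ?_
      (fun q ↦ γ.trans (P q.2)) ?_
    · refine Path.symm_continuous_family (fun q : A a × A b ↦ P q.1) ?_
      exact (hP a).comp ((continuous_fst.comp continuous_fst).prodMk continuous_snd)
    · refine Path.trans_continuous_family (fun _ : A a × A b ↦ γ) ?_ (fun q ↦ P q.2) ?_
      · exact γ.continuous.comp continuous_snd
      · exact (hP b).comp ((continuous_snd.comp continuous_fst).prodMk continuous_snd)
  have hnhds := (hW.preimage hcont).mem_nhds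
    (show ((⟨.const I a, rfl⟩, ⟨.const I b, rfl⟩) : A a × A b) ∈ _ from hγ)
  rw [nhds_prod_eq, mem_prod_iff] at hnhds
  obtain ⟨S, hS, T, hT, hST⟩ := hnhds
  -- In the compact-open topology, maps into small neighbourhoods of `x` are close to `const x`.
  have small {x : X} {S : Set (A x)} (hS : S ∈ 𝓝 (⟨.const I x, rfl⟩ : A x)) :
      ∃ U ∈ 𝓝 x, ∀ α : A x, (∀ t, α.1 t ∈ U) → α ∈ S := by
    obtain ⟨S', hS', hSS'⟩ := (mem_nhds_subtype _ _ _).1 hS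
    obtain ⟨⟨_, U⟩, ⟨-, hU⟩, hUS⟩ :=
      ((𝓝 x).basis_sets.nhds_continuousMapConst (X := I)).mem_iff.1 hS'
    exact ⟨U, hU, fun α hα ↦ hSS' (hUS fun t _ ↦ hα t)⟩
  obtain ⟨U, hU, hUS⟩ := small hS
  obtain ⟨V, hV, hVT⟩ := small hT
  refine ⟨U, hU, V, hV, fun a' b' α β hα hβ ↦ ?_⟩
  have mem := hST (show ((⟨α, α.source⟩, ⟨β, β.source⟩) : A a × A b) ∈ S ×ˢ T from
    ⟨hUS _ hα, hVT _ hβ⟩)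
  obtain ⟨α, hα0, rfl⟩ := α
  obtain ⟨β, hβ0, rfl⟩ := β
  exact mem

/-! ### The topology of the space of homotopy classes -/

namespace Pi1

/-- The homotopy class of a path. -/
def mk (f : C(I, X)) : Pi1 X := Quotient.mk (pathHomotopySetoid X) f

theorem isQuotientMap_mk : IsQuotientMap (mk : C(I, X) → Pi1 X) := isQuotientMap_quotient_mk'

theorem mk_eq_mk_iff {f g : C(I, X)} : mk f = mk g ↔ f.HomotopicRel g {0, 1} := Quotient.eq

theorem mk_eq_mk_of_homotopic {a b : X} {γ γ' : Path a b} (h : γ.Homotopic γ') :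
    mk (γ : C(I, X)) = mk (γ' : C(I, X)) := mk_eq_mk_iff.2 h

/-- The endpoints of a homotopy class of paths. -/
def endpoints : Pi1 X → X × X :=
  Quotient.lift (fun f : C(I, X) ↦ (f 0, f 1)) fun _ _ h ↦
    Prod.ext (h.some.fst_eq_snd (by simp)) (h.some.fst_eq_snd (by simp))

@[simp] theorem endpoints_mk (f : C(I, X)) : endpoints (mk f) = (f 0, f 1) := rfl

theorem continuous_endpoints : Continuous (endpoints : Pi1 X → X × X) :=
  isQuotientMap_mk.continuous_iff.2
    ((continuous_eval_const (F := C(I, X)) 0).prodMk (continuous_eval_const (F := C(I, X)) 1))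

/-- The classes of constant paths form a retract of `Pi1 X` homeomorphic to `X`. -/
theorem isEmbedding_mk_const : IsEmbedding fun x : X ↦ mk (.const I x) :=
  Function.LeftInverse.isEmbedding (f := fun g : Pi1 X ↦ (endpoints g).1) (fun _ ↦ rfl)
    (continuous_fst.comp continuous_endpoints)
    (isQuotientMap_mk.continuous.comp ContinuousMap.continuous_const')

/-- The classes of the paths obtained from `γ` by moving its source within `U` and its target
within `V`. -/
def slideSet (U V : Set X) {a b : X} (γ : Path a b) : Set (Pi1 X) :=
  {g | ∃ (a' b' : X) (γ' : Path a' b'), mk (γ' : C(I, X)) = g ∧ Slide U V γ γ'}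

variable {U V : Set X} {a b a' b' : X}

theorem mk_mem_slideSet {γ : Path a b} {γ' : Path a' b'} :
    mk (γ' : C(I, X)) ∈ slideSet U V γ ↔ Slide U V γ γ' := by
  refine ⟨?_, fun h ↦ ⟨a', b', γ', rfl, h⟩⟩
  rintro ⟨a'', b'', γ'', h, hs⟩
  have he := congrArg endpoints h
  obtain rfl : a'' = a' := by simpa using congrArg Prod.fst he
  obtain rfl : b'' = b' := by simpa using congrArg Prod.snd he
  exact hs.congr (.refl _) (mk_eq_mk_iff.1 h)

theorem slideSet_subset {γ : Path a b} {γ' : Path a' b'} (h : Slide U V γ γ') :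
    slideSet U V γ' ⊆ slideSet U V γ := by
  rintro _ ⟨a'', b'', γ'', rfl, h'⟩
  exact mk_mem_slideSet.2 (h.trans h')

theorem slideSet_congr {γ : Path a b} {γ' : Path a' b'} (h : Slide U V γ γ') :
    slideSet U V γ = slideSet U V γ' :=
  (slideSet_subset h.symm).antisymm (slideSet_subset h)

/-- Around a path in the set, the ladder argument yields further slides within the same `U` and
`V`. -/
theorem isOpen_slideSet [LocallyPathConnectedSpace X] (hX : SemilocallySimplyConnected X)
    (hU : IsOpen U) (hV : IsOpen V)
    (γ : Path a b) : IsOpen (slideSet U V γ) := by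
  rw [← isQuotientMap_mk.isOpen_preimage, isOpen_iff_mem_nhds]
  intro f hf
  have hs : Slide U V γ f.toPath := mk_mem_slideSet.1 hf
  have h0 : f 0 ∈ U := by
    obtain ⟨α, -, hα, -, -⟩ := hs
    exact α.target ▸ hα 1
  have h1 : f 1 ∈ V := by
    obtain ⟨-, β, -, hβ, -⟩ := hs
    exact β.target ▸ hβ 1
  filter_upwards [eventually_slide hX f (hU.mem_nhds h0) (hV.mem_nhds h1)] with g hg
  exact mk_mem_slideSet.2 (hs.trans hg)

theorem mk_mem_slideSet_self {γ : Path a b} (ha : a ∈ U) (hb : b ∈ V) :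
    mk (γ : C(I, X)) ∈ slideSet U V γ :=
  mk_mem_slideSet.2 (.of_homotopic ha hb (.refl _))

/-- The preimage of `O` in `C(I, X)` is saturated, so it contains `γ` with constant paths attached at
both ends, although that path need not be close to `γ`. -/
theorem exists_slideSet_subset {O : Set (Pi1 X)} (hO : IsOpen O) {γ : Path a b}
    (hγ : mk (γ : C(I, X)) ∈ O) : ∃ U ∈ 𝓝 a, ∃ V ∈ 𝓝 b, slideSet U V γ ⊆ O := by
  have hstart :
      mk (((Path.refl a).symm.trans (γ.trans (Path.refl b)) : Path a b) : C(I, X)) ∈ O := by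
    rw [mk_eq_mk_of_homotopic (γ' := γ)]
    · exact hγ
    · rw [← Path.Homotopic.Quotient.eq]
      simp
  obtain ⟨U, hU, V, hV, h⟩ :=
    exists_nhds_forall_trans_mem γ (hO.preimage isQuotientMap_mk.continuous) hstart
  refine ⟨U, hU, V, hV, ?_⟩
  rintro _ ⟨a', b', γ', rfl, α, β, hα, hβ, hαβ⟩
  rw [mk_eq_mk_of_homotopic (γ' := α.symm.trans (γ.trans β))]
  · exact h α β hα hβ
  · rw [← Path.Homotopic.Quotient.eq]
    simp [hαβ, Path.Homotopic.Quotient.symm_trans_cancel_left]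

theorem secondCountableTopology [LocallyPathConnectedSpace X]
    (hX : SemilocallySimplyConnected X) [SecondCountableTopology X] :
    SecondCountableTopology (Pi1 X) := by
  obtain ⟨D, hDc, hD⟩ := exists_countable_dense C(I, X)
  let B := countableBasis X
  have hB : IsTopologicalBasis B := isBasis_countableBasis X
  let S : Set (Set (Pi1 X)) := (fun q : C(I, X) × Set X × Set X ↦
    slideSet q.2.1 q.2.2 q.1.toPath) '' (D ×ˢ B ×ˢ B)
  have hS : IsTopologicalBasis S := by
    refine isTopologicalBasis_of_isOpen_of_nhds ?_ fun g O hg hO ↦ ?_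
    · rintro _ ⟨⟨d, U, V⟩, ⟨-, hU, hV⟩, rfl⟩
      exact isOpen_slideSet hX (hB.isOpen hU) (hB.isOpen hV) _
    · obtain ⟨f, rfl⟩ := isQuotientMap_mk.surjective g
      obtain ⟨U₀, hU₀, V₀, hV₀, hUV⟩ := exists_slideSet_subset hO (γ := f.toPath) hg
      obtain ⟨U, hUB, h0, hU⟩ := hB.mem_nhds_iff.1 hU₀
      obtain ⟨V, hVB, h1, hV⟩ := hB.mem_nhds_iff.1 hV₀
      obtain ⟨d, hd, hdD⟩ := hD.inter_nhds_nonempty (eventually_slide hX f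
        ((hB.isOpen hUB).mem_nhds h0) ((hB.isOpen hVB).mem_nhds h1))
      refine ⟨slideSet U V d.toPath, ⟨(d, U, V), ⟨hd, hUB, hVB⟩, rfl⟩, ?_⟩
      -- The path `d` is a slide of `f`, so the basic set it indexes is also the one around `f`.
      rw [← slideSet_congr hdD]
      refine ⟨mk_mem_slideSet_self (γ := f.toPath) h0 h1, subset_trans ?_ hUV⟩
      rintro _ ⟨a, b, γ, rfl, hγ⟩
      exact mk_mem_slideSet.2 (hγ.mono hU hV)
  exact hS.secondCountableTopology
    ((hDc.prod ((countable_countableBasis X).prod (countable_countableBasis X))).image _)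

theorem t2Space [LocallyPathConnectedSpace X] (hX : SemilocallySimplyConnected X)
    [T2Space X] : T2Space (Pi1 X) := by
  refine ⟨fun g g' hne ↦ ?_⟩
  by_cases he : endpoints g = endpoints g'
  · obtain ⟨f, rfl⟩ := isQuotientMap_mk.surjective g
    obtain ⟨f', rfl⟩ := isQuotientMap_mk.surjective g'
    simp only [endpoints_mk, Prod.mk.injEq] at he
    let γ : Path (f 0) (f 1) := f.toPath
    let γ' : Path (f 0) (f 1) := ⟨f', he.1.symm, he.2.symm⟩
    obtain ⟨U, hU, hUs⟩ := hX.exists_isRelSimplyConnected (f 0)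
    obtain ⟨V, hV, hVs⟩ := hX.exists_isRelSimplyConnected (f 1)
    have h0 := mem_interior_iff_mem_nhds.2 hU
    have h1 := mem_interior_iff_mem_nhds.2 hV
    refine ⟨slideSet (interior U) (interior V) γ, slideSet (interior U) (interior V) γ',
      isOpen_slideSet hX isOpen_interior isOpen_interior _,
      isOpen_slideSet hX isOpen_interior isOpen_interior _,
      mk_mem_slideSet_self (γ := γ) h0 h1, mk_mem_slideSet_self (γ := γ') h0 h1, ?_⟩
    rw [Set.disjoint_left]
    rintro _ ⟨a, b, δ, rfl, hδ⟩ hδ'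
    exact hne (mk_eq_mk_of_homotopic (γ := γ) (γ' := γ')
      (hδ.homotopic_of_slide (hUs.mono interior_subset) (hVs.mono interior_subset)
        (mk_mem_slideSet.1 hδ')))
  · exact separated_by_continuous continuous_endpoints he

end Pi1

/-! ### Covering spaces -/

namespace IsCoveringMap

variable {E : Type*} [TopologicalSpace E] {p : E → X}

/-- Lifts of paths from a point in the image reach every fibre. -/
theorem surjective_of_pathConnected [Nonempty E] [PathConnectedSpace X] (hp : IsCoveringMap p) :
    Function.Surjective p := by
  intro x
  obtain ⟨e⟩ := ‹Nonempty E›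
  obtain ⟨γ⟩ := PathConnectedSpace.joined (p e) x
  refine ⟨hp.liftPath γ e γ.source 1, ?_⟩
  simpa using congrFun (hp.liftPath_lifts γ e γ.source) 1

/-- The paths from `p e` to `x` form a separable space which maps onto the discrete fibre over `x`
by lifting to `e`. -/
theorem countable_fiber [PathConnectedSpace E] [SecondCountableTopology X] (hp : IsCoveringMap p)
    (x : X) : Countable (p ⁻¹' {x}) := by
  obtain ⟨e⟩ := (inferInstance : Nonempty E)
  let A : Set C(I, X) := {γ | γ 0 = p e ∧ γ 1 = x}
  let H : C(I × A, X) := ⟨fun q ↦ q.2.1 q.1, by fun_prop⟩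
  let L := hp.liftHomotopy H (.const A e) fun a ↦ a.2.1
  have hL : p ∘ L = H := hp.liftHomotopy_lifts H (.const A e) fun a ↦ a.2.1
  let T : A → p ⁻¹' {x} := fun a ↦ ⟨L (1, a), (congrFun hL (1, a)).trans a.2.2⟩
  have hT : Continuous T := by fun_prop
  have hTs : Function.Surjective T := by
    rintro ⟨e', rfl⟩
    obtain ⟨Γ⟩ := PathConnectedSpace.joined e e'
    let a : A := ⟨⟨p ∘ Γ, hp.continuous.comp Γ.continuous⟩, by simp, by simp⟩
    have : (Γ : C(I, E)) = hp.liftPath a.1 e a.2.1 :=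
      (hp.eq_liftPath_iff' a.2.1).2 ⟨rfl, Γ.source⟩
    refine ⟨a, Subtype.ext ?_⟩
    calc L (1, a) = hp.liftPath a.1 e a.2.1 1 := rfl
      _ = e' := by rw [← this]; exact Γ.target
  have : DiscreteTopology (p ⁻¹' {x}) := (hp x).discreteTopology_fiber
  have : SeparableSpace (p ⁻¹' {x}) := hTs.denseRange.separableSpace hT
  exact separableSpace_iff_countable.1 this

/-- The open sets `p ⁻¹' U ≃ₜ U × p ⁻¹' {x}` are second countable, and countably many cover `E`. -/
theorem secondCountableTopology [PathConnectedSpace E] [SecondCountableTopology X]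
    (hp : IsCoveringMap p) : SecondCountableTopology E := by
  choose hdisc U hxU hU hpU H _ using id hp
  obtain ⟨s, hs, hsU⟩ := TopologicalSpace.countable_cover_nhds fun x ↦ (hU x).mem_nhds (hxU x)
  have := hs.to_subtype
  have (x : s) : SecondCountableTopology (p ⁻¹' U x) := by
    have := hdisc x
    have := hp.countable_fiber (x : X)
    exact (H x).isEmbedding.secondCountableTopology
  refine secondCountableTopology_of_countable_cover (U := fun x : s ↦ p ⁻¹' U x)
    (fun x ↦ hpU x) (eq_univ_of_forall fun e ↦ ?_)
  have : p e ∈ ⋃ x ∈ s, U x := hsU ▸ mem_univ _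
  simpa using this

theorem t2Space [T2Space X] (hp : IsCoveringMap p) : T2Space E := by
  refine ⟨fun e e' hne ↦ ?_⟩
  by_cases h : p e = p e'
  · exact hp.isSeparatedMap e e' h hne
  · exact separated_by_continuous hp.continuous h

end IsCoveringMap

end

theorem mainTheorem8 {X : Type*} [TopologicalSpace X] [LocallyPathConnectedSpace X]
    (hX : SemilocallySimplyConnected X) :
    (∀ {E : Type*} [TopologicalSpace E] [PathConnectedSpace X] [SimplyConnectedSpace E]
        (p : E → X), IsCoveringMap p →
      List.TFAE [SecondCountableTopology X, SecondCountableTopology E,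
        SecondCountableTopology C(I, X), SecondCountableTopology (Pi1 X)] ∧
      (T2Space X →
        List.TFAE [HausdorffSecondCountable X, HausdorffSecondCountable E,
          HausdorffSecondCountable C(I, X), HausdorffSecondCountable (Pi1 X)])) ∧
    List.TFAE [SecondCountableTopology X, SecondCountableTopology C(I, X),
      SecondCountableTopology (Pi1 X)] ∧
    List.TFAE [HausdorffSecondCountable X, HausdorffSecondCountable C(I, X),
      HausdorffSecondCountable (Pi1 X)] := by
  have path : SecondCountableTopology X ↔ SecondCountableTopology C(I, X) :=
    ⟨fun _ ↦ inferInstance,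
      fun _ ↦ ContinuousMap.isEmbedding_const_unitInterval.secondCountableTopology⟩
  have pi1 : SecondCountableTopology X ↔ SecondCountableTopology (Pi1 X) :=
    ⟨fun _ ↦ Pi1.secondCountableTopology hX,
      fun _ ↦ Pi1.isEmbedding_mk_const.secondCountableTopology⟩
  have path2 : T2Space X ↔ T2Space C(I, X) :=
    ⟨fun _ ↦ inferInstance, fun _ ↦ ContinuousMap.isEmbedding_const_unitInterval.t2Space⟩
  have pi2 : T2Space X ↔ T2Space (Pi1 X) :=
    ⟨fun _ ↦ Pi1.t2Space hX, fun _ ↦ Pi1.isEmbedding_mk_const.t2Space⟩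
  refine ⟨fun {E} _ _ _ p hp ↦ ?_, ?_, ?_⟩
  · have cover : SecondCountableTopology X ↔ SecondCountableTopology E :=
      ⟨fun _ ↦ hp.secondCountableTopology, fun _ ↦
        (hp.isQuotientMap hp.surjective_of_pathConnected).secondCountableTopology hp.isOpenMap⟩
    refine ⟨?_, fun hT ↦ ?_⟩
    · tfae_have 1 ↔ 2 := cover
      tfae_have 1 ↔ 3 := path
      tfae_have 1 ↔ 4 := pi1
      tfae_finish
    · tfae_have 1 ↔ 2 := and_congr (iff_of_true hT hp.t2Space) cover
      tfae_have 1 ↔ 3 := and_congr path2 path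
      tfae_have 1 ↔ 4 := and_congr pi2 pi1
      tfae_finish
  · tfae_have 1 ↔ 2 := path
    tfae_have 1 ↔ 3 := pi1
    tfae_finish
  · tfae_have 1 ↔ 2 := and_congr path2 path
    tfae_have 1 ↔ 3 := and_congr pi2 pi1
    tfae_finish
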